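/- Let $\|\cdot\|$ be an arbitrary norm on $\mathbb{R}^d$, let $\operatorname{dist}(x,Q)=\inf_{y\in Q}\|x-y\|$ and $U(x,r)=\{y : \|x-y\|<r\}$. A polyhedral set is an intersection of finitely many closed half-spaces. A function $f\colon\mathbb{R}^d\to\mathbb{R}$ is piecewise affine if there are polyhedral sets $Q_1,\dots,Q_s$ with nonempty, pairwise disjoint interiors and $\bigcup_i Q_i=\mathbb{R}^d$, and affine functions $f_1,\dots,f_s\colon\mathbb{R}^d\to\mathbb{R}$, such that $f=f_i$ on $Q_i$ for every $i$. Put $S(f)=\{x : f(x)\le 0\}$ and $[f]_+(x)=\max\{f(x),0\}$. The function $f$ has an error bound with constant $\tau>0$ on a set $V\subseteq\mathbb{R}^d$ if $$\tau\,\operatorname{dist}(x,S(f))\le [f]_+(x)\quad\text{for all } x\in V;$$ the supremum of all such $\tau$ is denoted by $\tau(V)\in[0,+\infty]$ (with $\tau(V)=0$ if there are none). It has an error bound at a point $\bar x\in S(f)$ if it has an error bound, with some constant $\tau>0$, on some neighbourhood of $\bar x$. Let $f\colon\mathbb{R}^d\to\mathbb{R}$ be piecewise affine. Then $f$ has an error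 bound at every $\bar x\in S(f)$. Furthermore, if $S(f)$ is nonempty, then there exist $r>0$ and $\tau_0>0$ such that $\tau(U(\bar x,r))\ge\tau_0$ for all $\bar x\in S(f)$. -/

import Mathlib

namespace PiecewiseAffine

section Polyhedral

variable {E : Type*} [NormedAddCommGroup E] [NormedSpace ℝ E]

/-- A closed half-space `{x | ⟨v, x⟩ ≤ b}` with `v ≠ 0`. -/
def IsClosedHalfSpace (H : Set E) : Prop :=
  ∃ (φ : E →L[ℝ] ℝ) (b : ℝ), φ ≠ 0 ∧ H = {x | φ x ≤ b}

/-- A polyhedral set: the intersection of a finite number of closed half-spaces. -/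
def IsPolyhedral (Q : Set E) : Prop :=
  ∃ 𝓗 : Set (Set E), 𝓗.Finite ∧ (∀ H ∈ 𝓗, IsClosedHalfSpace H) ∧ Q = ⋂₀ 𝓗

/-- A polyhedral partition of the space: finitely many polyhedral sets that cover the space and
whose interiors are nonempty and pairwise disjoint. -/
structure IsPolyhedralPartition {s : ℕ} (Q : Fin s → Set E) : Prop where
  polyhedral : ∀ i, IsPolyhedral (Q i)
  cover : ⋃ i, Q i = Set.univ
  interior_nonempty : ∀ i, (interior (Q i)).Nonempty
  interior_disjoint : ∀ i j, i ≠ j → interior (Q i) ∩ interior (Q j) = ∅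

/-- A function is piecewise affine if it coincides with an affine function on each member of
some polyhedral partition of the space. -/
def IsPiecewiseAffine {G : Type*} [AddCommGroup G] [Module ℝ G] (F : E → G) : Prop :=
  ∃ (s : ℕ) (Q : Fin s → Set E) (A : Fin s → (E →ᵃ[ℝ] G)),
    IsPolyhedralPartition Q ∧ ∀ i, ∀ x ∈ Q i, F x = A i x

end Polyhedral

section ErrorBound

variable {E : Type*} [NormedAddCommGroup E]

/-- The lower `0`-level set `S(f) = {x | f x ≤ 0}`. -/
def lowerLevel (f : E → ℝ) : Set E := {x | f x ≤ 0}

/-- `f` has an error bound with constant `τ > 0` on `V`: `τ * dist(x, S(f)) ≤ [f]₊(x)` on `V`.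
The notion is meant for functions with nonempty `S(f)`. -/
def HasErrorBoundOn (f : E → ℝ) (V : Set E) (τ : ℝ) : Prop :=
  0 < τ ∧ ∀ x ∈ V, τ * Metric.infDist x (lowerLevel f) ≤ max (f x) 0

/-- `f` has an error bound at the point `x₀`: it has one on some neighbourhood of `x₀`. -/
def HasErrorBoundAt (f : E → ℝ) (x₀ : E) : Prop :=
  ∃ τ : ℝ, ∃ V ∈ nhds x₀, HasErrorBoundOn f V τ

/-- The error bound constant `τ(f, V)`: the supremum of all constants `τ > 0` with which `f` has
an error bound on `V`. It is `∞` when these are unbounded (as for `V ⊆ S(f)`), and `0` when there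
are none. -/
noncomputable def errorBoundConst (f : E → ℝ) (V : Set E) : ENNReal :=
  ⨆ (τ : ℝ) (_ : HasErrorBoundOn f V τ), ENNReal.ofReal τ

end ErrorBound

end PiecewiseAffine

namespace PiecewiseAffine

open Filter Topology

/-! On a piece `Q i`, the inequalities defining `Q i` together with `A i ≤ 0` form a finite linear
system whose solutions lie in `lowerLevel f`, and a point of `Q i` violates it by at most `max (f x)
0`. A local Hoffman bound (`isStableSystem_of_finite`, by Fourier–Motzkin elimination) puts a
solution within a multiple of that violation when it is small; when it is not, it dominates the
distance truncated at `1`. On unit balls centred in `lowerLevel f` the truncation is void, and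
finitely many pieces leave one constant. -/

/-- Finitely many lower bounds and finitely many upper bounds that are compatible with each other
and with `[-M, M]` have a common point in `[-M, M]`. -/
theorem exists_abs_le_between {ι κ : Type*} {s : Set ι} {t : Set κ} (hs : s.Finite)
    {l : ι → ℝ} {u : κ → ℝ} {M : ℝ} (hM : 0 ≤ M) (hlu : ∀ i ∈ s, ∀ k ∈ t, l i ≤ u k)
    (hl : ∀ i ∈ s, l i ≤ M) (hu : ∀ k ∈ t, -M ≤ u k) :
    ∃ r : ℝ, |r| ≤ M ∧ (∀ i ∈ s, l i ≤ r) ∧ ∀ k ∈ t, r ≤ u k := by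
  obtain ⟨r, hr, hmax⟩ := Set.exists_max_image (insert (-M) (l '' s)) id
    ((hs.image l).insert _) (Set.insert_nonempty _ _)
  refine ⟨r, abs_le.2 ⟨hmax _ (Set.mem_insert _ _), ?_⟩,
    fun i hi => hmax _ (Set.mem_insert_of_mem _ ⟨i, hi, rfl⟩), fun k hk => ?_⟩
  · rcases hr with rfl | ⟨i, hi, rfl⟩
    · linarith
    · exact hl i hi
  · rcases hr with rfl | ⟨i, hi, rfl⟩
    · exact hu k hk
    · exact hlu i hi k hk

/-- A real function on a finite set has a common bound. -/
theorem exists_one_le_forall_le {ι : Type*} {s : Set ι} (hs : s.Finite) (h : ι → ℝ) :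
    ∃ K : ℝ, 1 ≤ K ∧ ∀ i ∈ s, h i ≤ K :=
  ((eventually_ge_atTop 1).and
    ((eventually_all_finite hs).2 fun i _ => eventually_ge_atTop (h i))).exists

variable {E : Type*} [NormedAddCommGroup E] [NormedSpace ℝ E]

/-- The system of inequalities `φ x ≤ b`, `(φ, b) ∈ S`, is *stable* if every point that violates
them by at most a small `δ` is within `C * δ` of a solution. -/
def IsStableSystem (S : Set ((E →L[ℝ] ℝ) × ℝ)) : Prop :=
  ∃ C > (0 : ℝ), ∃ δ₀ > (0 : ℝ), ∀ δ : ℝ, 0 ≤ δ → δ < δ₀ → ∀ x : E,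
    (∀ g ∈ S, g.1 x ≤ g.2 + δ) → ∃ p : E, (∀ g ∈ S, g.1 p ≤ g.2) ∧ ‖x - p‖ ≤ C * δ

/-- Each inequality reads `0 ≤ b`. With `δ₀` at most every positive `-b`, an inconsistent system
admits no point of violation below `δ₀`, so stability is vacuous; otherwise `x` itself is a
solution. -/
theorem isStableSystem_of_forall_eq_zero {S : Set ((E →L[ℝ] ℝ) × ℝ)} (hS : S.Finite)
    (h0 : ∀ g ∈ S, g.1 = 0) : IsStableSystem S := by
  obtain ⟨K, hK, hKS⟩ := exists_one_le_forall_le hS fun g => (-g.2)⁻¹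
  refine ⟨1, one_pos, K⁻¹, by positivity, fun δ hδ hδK x hx => ⟨x, fun g hg => ?_, by simpa⟩⟩
  have h1 := hx g hg
  rw [h0 g hg] at h1 ⊢
  simp only [_root_.zero_apply] at h1 ⊢
  by_contra! hneg
  have h2 : K⁻¹ ≤ -g.2 := inv_le_of_inv_le₀ (by linarith) (hKS g hg)
  linarith

/-- The combination of two inequalities in which the direction `e` cancels. -/
def eliminate (e : E) (g h : (E →L[ℝ] ℝ) × ℝ) : (E →L[ℝ] ℝ) × ℝ :=
  (g.1 e • h.1 - h.1 e • g.1, g.1 e * h.2 - h.1 e * g.2)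

/-- The Fourier–Motzkin elimination of the direction `e` from a system of inequalities. -/
def eliminateSystem (e : E) (S : Set ((E →L[ℝ] ℝ) × ℝ)) : Set ((E →L[ℝ] ℝ) × ℝ) :=
  {g ∈ S | g.1 e = 0} ∪ Set.image2 (eliminate e) {g ∈ S | 0 < g.1 e} {g ∈ S | g.1 e < 0}

theorem finite_eliminateSystem {S : Set ((E →L[ℝ] ℝ) × ℝ)} (hS : S.Finite) (e : E) :
    (eliminateSystem e S).Finite :=
  (hS.sep _).union (Set.Finite.image2 _ (hS.sep _) (hS.sep _))

/-- A solution `q` of the eliminated system near `x` is corrected by a shift `r • e`. The combined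
inequalities say exactly that the lower bounds on `r` stay below the upper ones, and `r` can be
small because `q` nearly solves `S`. -/
theorem IsStableSystem.of_eliminateSystem {S : Set ((E →L[ℝ] ℝ) × ℝ)} (hS : S.Finite) (e : E)
    (h : IsStableSystem (eliminateSystem e S)) : IsStableSystem S := by
  obtain ⟨C, hC, δ₀, hδ₀, H⟩ := h
  obtain ⟨K₁, hK₁, hKS₁⟩ := exists_one_le_forall_le hS fun g => |g.1 e|
  obtain ⟨K₂, hK₂, hKS₂⟩ := exists_one_le_forall_le hS fun g => |g.1 e|⁻¹
  obtain ⟨K₃, hK₃, hKS₃⟩ := exists_one_le_forall_le hS fun g => ‖g.1‖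
  set N : ℝ := 1 + K₃ * (C * (2 * K₁)) with hN
  have hN0 : 0 < N := by positivity
  refine ⟨C * (2 * K₁) + K₂ * N * ‖e‖, by positivity, δ₀ / (2 * K₁), by positivity,
    fun δ hδ hδlt x hx => ?_⟩
  -- A combination adds two violations with weights at most `K₁` each; inequalities kept unchanged
  -- are covered since `1 ≤ K₁`.
  obtain ⟨q, hq, hxq⟩ := H (2 * K₁ * δ) (by positivity)
    (by rw [lt_div_iff₀ (by positivity)] at hδlt; linarith) x (by
      rintro _ (⟨hg, -⟩ | ⟨g, ⟨hg, hge⟩, k, ⟨hk, hke⟩, rfl⟩)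
      · have := hx _ hg
        nlinarith
      · have h1 := hx _ hg
        have h2 := hx _ hk
        have h3 := (abs_le.1 (hKS₁ _ hg)).2
        have h4 := (abs_le.1 (hKS₁ _ hk)).1
        have h5 := mul_le_mul_of_nonneg_left h2 hge.le
        have h6 := mul_le_mul_of_nonneg_left h1 (neg_nonneg.2 hke.le)
        have h7 := mul_le_mul_of_nonneg_right h3 hδ
        have h8 := mul_le_mul_of_nonneg_right h4 hδ
        simp only [eliminate, _root_.sub_apply, _root_.smul_apply,
          smul_eq_mul]
        linarith)
  have hviol : ∀ g ∈ S, g.1 q - g.2 ≤ N * δ := fun g hg => by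
    have h1 : g.1 (q - x) ≤ K₃ * (C * (2 * K₁ * δ)) :=
      calc g.1 (q - x) ≤ ‖g.1 (q - x)‖ := Real.le_norm_self _
        _ ≤ ‖g.1‖ * ‖q - x‖ := g.1.le_opNorm _
        _ ≤ K₃ * (C * (2 * K₁ * δ)) := by
          rw [norm_sub_rev]
          exact mul_le_mul (hKS₃ g hg) hxq (norm_nonneg _) (by positivity)
    have h2 := hx g hg
    rw [map_sub] at h1
    rw [hN]
    linarith
  have hviol' : ∀ g ∈ S, (g.1 q - g.2) * |g.1 e|⁻¹ ≤ K₂ * N * δ := fun g hg =>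
    calc (g.1 q - g.2) * |g.1 e|⁻¹ ≤ N * δ * |g.1 e|⁻¹ :=
          mul_le_mul_of_nonneg_right (hviol g hg) (by positivity)
      _ ≤ N * δ * K₂ := mul_le_mul_of_nonneg_left (hKS₂ g hg) (by positivity)
      _ = K₂ * N * δ := by ring
  obtain ⟨r, hr, hlr, hru⟩ := exists_abs_le_between (s := {g ∈ S | g.1 e < 0})
    (t := {g ∈ S | 0 < g.1 e}) (l := fun g => (g.2 - g.1 q) / g.1 e)
    (u := fun g => (g.2 - g.1 q) / g.1 e) (M := K₂ * N * δ) (hS.sep _) (by positivity)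
    (by
      rintro k ⟨hk, hke⟩ g ⟨hg, hge⟩
      have h1 := hq _ (Or.inr ⟨g, ⟨hg, hge⟩, k, ⟨hk, hke⟩, rfl⟩)
      simp only [eliminate, _root_.sub_apply, _root_.smul_apply,
        smul_eq_mul] at h1
      rw [div_le_iff_of_neg hke, div_mul_eq_mul_div, div_le_iff₀ hge]
      linarith)
    (by
      rintro g ⟨hg, hge⟩
      have h1 := hviol' g hg
      rw [abs_of_neg hge, inv_neg] at h1
      rw [div_eq_mul_inv]
      linarith)
    (by
      rintro g ⟨hg, hge⟩
      have h1 := hviol' g hg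
      rw [abs_of_pos hge] at h1
      rw [div_eq_mul_inv]
      linarith)
  refine ⟨q + r • e, fun g hg => ?_, ?_⟩
  · rw [map_add, map_smul, smul_eq_mul]
    rcases lt_trichotomy (g.1 e) 0 with hge | hge | hge
    · have := hlr g ⟨hg, hge⟩
      rw [div_le_iff_of_neg hge] at this
      linarith
    · rw [hge, mul_zero, add_zero]
      exact hq g (Or.inl ⟨hg, hge⟩)
    · have := hru g ⟨hg, hge⟩
      rw [le_div_iff₀ hge] at this
      linarith
  · calc ‖x - (q + r • e)‖ = ‖(x - q) - r • e‖ := by rw [sub_sub]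
      _ ≤ ‖x - q‖ + ‖r • e‖ := norm_sub_le _ _
      _ ≤ C * (2 * K₁ * δ) + K₂ * N * δ * ‖e‖ := by
        rw [norm_smul, Real.norm_eq_abs]
        gcongr
      _ = (C * (2 * K₁) + K₂ * N * ‖e‖) * δ := by ring

/-- `V` holds the directions already eliminated and `D` those still to go. Elimination preserves
vanishing on `V`; once `V` alone spans, every functional is zero. -/
theorem isStableSystem_of_span_eq_top (D : Finset E) :
    ∀ (V : Set E), Submodule.span ℝ (V ∪ D) = ⊤ → ∀ S : Set ((E →L[ℝ] ℝ) × ℝ), S.Finite →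
      (∀ g ∈ S, ∀ v ∈ V, g.1 v = 0) → IsStableSystem S := by
  classical
  induction D using Finset.induction_on with
  | empty =>
    intro V hV S hS h0
    refine isStableSystem_of_forall_eq_zero hS fun g hg => ?_
    rw [Finset.coe_empty, Set.union_empty] at hV
    exact ContinuousLinearMap.coe_injective (LinearMap.ext_on hV fun v hv => h0 g hg v hv)
  | insert e D _ ih =>
    intro V hV S hS h0
    refine .of_eliminateSystem hS e (ih (insert e V) ?_ _ (finite_eliminateSystem hS e) ?_)
    · rwa [Finset.coe_insert, Set.union_insert, ← Set.insert_union] at hV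
    · rintro _ (⟨hg, hge⟩ | ⟨g, ⟨hg, -⟩, k, ⟨hk, -⟩, rfl⟩) v (rfl | hv)
      · exact hge
      · exact h0 _ hg v hv
      · simp [eliminate, mul_comm]
      · simp [eliminate, h0 _ hg v hv, h0 _ hk v hv]

theorem isStableSystem_of_finite [FiniteDimensional ℝ E] {S : Set ((E →L[ℝ] ℝ) × ℝ)}
    (hS : S.Finite) : IsStableSystem S := by
  obtain ⟨D, hD⟩ := (Module.Finite.fg_top : (⊤ : Submodule ℝ E).FG)
  exact isStableSystem_of_span_eq_top D ∅ (by rwa [Set.empty_union]) S hS (by simp)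

theorem IsPolyhedral.exists_finite_system {Q : Set E} (hQ : IsPolyhedral Q) :
    ∃ S : Set ((E →L[ℝ] ℝ) × ℝ), S.Finite ∧ ∀ x, x ∈ Q ↔ ∀ g ∈ S, g.1 x ≤ g.2 := by
  obtain ⟨𝓗, hfin, hH, rfl⟩ := hQ
  choose! φ b _ hφb using hH
  refine ⟨(fun H => (φ H, b H)) '' 𝓗, hfin.image _, fun x => ?_⟩
  rw [Set.mem_sInter, Set.forall_mem_image]
  refine forall₂_congr fun H hH => ?_
  conv_lhs => rw [hφb H hH]
  rfl

/-- On a polyhedral set `Q`, the positive part of an affine function `A` controls the distance,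
truncated at `1`, to any set that contains `Q ∩ {A ≤ 0}`. -/
theorem IsPolyhedral.exists_mul_min_infDist_le [FiniteDimensional ℝ E] {Q : Set E}
    (hQ : IsPolyhedral Q) (A : E →ᵃ[ℝ] ℝ) {L : Set E} (hL : ∀ x ∈ Q, A x ≤ 0 → x ∈ L) :
    ∃ τ > (0 : ℝ), ∀ x ∈ Q, τ * min (Metric.infDist x L) 1 ≤ max (A x) 0 := by
  obtain ⟨S, hS, hQS⟩ := hQ.exists_finite_system
  have hA : ∀ x, A x = A.linear.toContinuousLinearMap x + A 0 := fun x =>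
    congrFun A.decomp x
  obtain ⟨C, hC, δ₀, hδ₀, H⟩ :=
    isStableSystem_of_finite (hS.insert (A.linear.toContinuousLinearMap, -A 0))
  refine ⟨min C⁻¹ δ₀, by positivity, fun x hx => ?_⟩
  have hd : 0 ≤ Metric.infDist x L := Metric.infDist_nonneg
  rcases lt_or_ge (max (A x) 0) δ₀ with hlt | hge
  · obtain ⟨p, hp, hxp⟩ := H _ (le_max_right _ _) hlt x (by
      rintro g (rfl | hg)
      · have := le_max_left (A x) 0
        rw [hA x] at this ⊢
        simp only
        linarith
      · exact ((hQS x).1 hx g hg).trans (le_add_of_nonneg_right (le_max_right _ _)))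
    have hpL : p ∈ L := by
      refine hL p ((hQS p).2 fun g hg => hp g (Or.inr hg)) ?_
      have := hp _ (Or.inl rfl)
      rw [hA p]
      simp only at this
      linarith
    calc min C⁻¹ δ₀ * min (Metric.infDist x L) 1 ≤ C⁻¹ * (C * max (A x) 0) := by
          refine mul_le_mul (min_le_left _ _) ((min_le_left _ _).trans ?_)
            (le_min hd zero_le_one) (by positivity)
          exact (Metric.infDist_le_dist_of_mem hpL).trans (dist_eq_norm x p ▸ hxp)
      _ = max (A x) 0 := inv_mul_cancel_left₀ hC.ne' _
  -- No nearby solution is available here, and `L` may even be far away: this is where the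
  -- truncation is needed.
  · calc min C⁻¹ δ₀ * min (Metric.infDist x L) 1 ≤ δ₀ * 1 :=
          mul_le_mul (min_le_right _ _) (min_le_right _ _) (le_min hd zero_le_one) hδ₀.le
      _ ≤ max (A x) 0 := by rwa [mul_one]

/-- A piecewise affine function has an error bound, with one constant, on all unit balls centred
in its lower level set. -/
theorem IsPiecewiseAffine.exists_hasErrorBoundOn_ball [FiniteDimensional ℝ E] {f : E → ℝ}
    (hf : IsPiecewiseAffine f) :
    ∃ τ : ℝ, ∀ x₀ ∈ lowerLevel f, HasErrorBoundOn f (Metric.ball x₀ 1) τ := by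
  obtain ⟨s, Q, A, hQ, hA⟩ := hf
  have key := fun i => (hQ.polyhedral i).exists_mul_min_infDist_le (A i) (L := lowerLevel f)
    fun x hx hAx => (hA i x hx).le.trans hAx
  choose τ hτ hτQ using key
  obtain ⟨K, hK, hKτ⟩ := exists_one_le_forall_le Set.finite_univ fun i => (τ i)⁻¹
  refine ⟨K⁻¹, fun x₀ hx₀ => ⟨by positivity, fun x hx => ?_⟩⟩
  obtain ⟨i, hi⟩ := Set.mem_iUnion.1 (hQ.cover.symm ▸ Set.mem_univ x)
  have hle : Metric.infDist x (lowerLevel f) ≤ 1 :=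
    (Metric.infDist_le_dist_of_mem hx₀).trans (Metric.mem_ball.1 hx).le
  have h1 := hτQ i x hi
  rw [min_eq_left hle, ← hA i x hi] at h1
  exact (mul_le_mul_of_nonneg_right (inv_le_of_inv_le₀ (hτ i) (hKτ i (Set.mem_univ i)))
    Metric.infDist_nonneg).trans h1

end PiecewiseAffine

theorem mainTheorem5 {E : Type*} [NormedAddCommGroup E] [NormedSpace ℝ E] [FiniteDimensional ℝ E]
    (f : E → ℝ) (hf : PiecewiseAffine.IsPiecewiseAffine f) :
    (∀ x₀ ∈ PiecewiseAffine.lowerLevel f, PiecewiseAffine.HasErrorBoundAt f x₀) ∧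
    ((PiecewiseAffine.lowerLevel f).Nonempty →
      ∃ r > (0 : ℝ), ∃ τ₀ > (0 : ℝ), ∀ x₀ ∈ PiecewiseAffine.lowerLevel f,
        ENNReal.ofReal τ₀ ≤ PiecewiseAffine.errorBoundConst f (Metric.ball x₀ r)) := by
  obtain ⟨τ, hτ⟩ := hf.exists_hasErrorBoundOn_ball
  refine ⟨fun x₀ hx₀ => ⟨τ, Metric.ball x₀ 1, Metric.ball_mem_nhds x₀ one_pos, hτ x₀ hx₀⟩, ?_⟩
  rintro ⟨y, hy⟩
  exact ⟨1, one_pos, τ, (hτ y hy).1, fun x₀ hx₀ =>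
    le_iSup₂ (f := fun (t : ℝ) (_ : PiecewiseAffine.HasErrorBoundOn f (Metric.ball x₀ 1) t) =>
      ENNReal.ofReal t) τ (hτ x₀ hx₀)⟩
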